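/- **Setting.** A *two-armed bandit task* $f$ is a pair of laws $\nu_1,\nu_2$ of real losses with finite means $\mu_1,\mu_2$; in every round the losses of the two arms are drawn from $\nu_1\otimes\nu_2$, independently over rounds, and $\ell^\star_f=\min(\mu_1,\mu_2)$. For $\alpha\in[1/2,1]$ the task is *heavy-tailed of order $1/\alpha$* if its losses are nonnegative, $\mu_1,\mu_2\in[0,1]$, and $\mathbb E_{X\sim\nu_a}|X-\mu_a|^{1/\alpha}\le 1$ for both arms $a$. A (possibly randomized) *learner* $\mathscr A$ chooses an arm from its own history of past arms and observed losses. A family $\mathcal F$ of tasks *admits an $\alpha$-regret lower bound* if there is $c>0$ such that for every learner $\mathscr A$ and every horizon $T\ge1$, $\sup_{f\in\mathcal F}\mathbb E[R_{\mathscr A}(T)]\ge c\,T^\alpha$, where $R_{\mathscr A}(T)$ is the cumulative loss of $\mathscr A$ on $f$ in $T$ rounds minus the comparator; this is required both for the comparator $T\ell^\star_f$ and for the comparator given by the cumulative loss of the arm that is best in hindsight. *Experts with limited advice.* There are $K$ experts; expert $k$ faces a task $f_k$, the tasks of different experts being independent. Each expert consists of a learning algorithm and an advice rule, both (possibly randomized)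 maps from its own learning history to an arm. In each round $t$ a (possibly randomized) meta-procedure $\mathcal P$ with per-round budget $M$ selects, from everything recorded in past rounds, a training set $S_t\subseteq[K]$ with $|S_t|\le M$ and an advisor $i_t\in S_t$. It incurs the loss $\ell_t$, in that round, of the arm of task $f_{i_t}$ advised by expert $i_t$; each expert $k\in S_t$ pulls the arm chosen by its learning algorithm, observes its loss and appends both to its history. The record of the round, available to $\mathcal P$ later, consists of $S_t$, $i_t$, the advised arm and $\ell_t$, and the arms and losses of the experts in $S_t$. The regret is $\mathrm{Reg}(T)=\sum_{t=1}^T \ell_t-T\min_{k\in[K]}\ell^\star_{f_k}$. **Theorem (Lower bound).** There are absolute constants $c_1,c_2,s_0>0$ such that for every $\alpha\in[1/2,1]$ there is a class $\mathcal F_\alpha$ of two-armed bandit tasks, all heavy-tailed of order $1/\alpha$, which admits an $\alpha$-regret lower bound and has the following property. For all integers $K,M,T\ge1$ with $\sqrt{\frac{K\log K}{MT}}\le s_0$, every meta-procedure with budget $M$ and every choice of the $K$ experts, $$\sup_{f_1,\dots,f_K\in\mathcal F_\alpha}\mathbb E\,\mathrm{Reg}(T)\ \ge\ c_1\sqrt{\frac{KT}{M}}+c_2\,T^\alpha\Bigl(\frac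 KM\Bigr)^{1-\alpha}.$$ -/

import Mathlib

open MeasureTheory

noncomputable section

/-! ### Two-armed stochastic bandit tasks -/

/-- A two-armed stochastic bandit task: each arm has a probability law of its (real) loss,
with a finite mean. -/
structure TwoArmedTask where
  law : Fin 2 → Measure ℝ
  isProb : ∀ a, IsProbabilityMeasure (law a)
  integrable : ∀ a, Integrable (fun x : ℝ => x) (law a)

namespace TwoArmedTask

instance (f : TwoArmedTask) (a : Fin 2) : IsProbabilityMeasure (f.law a) := f.isProb a

/-- Expected loss of an arm. -/
def mean (f : TwoArmedTask) (a : Fin 2) : ℝ := ∫ x, x ∂(f.law a)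

/-- Smallest expected loss of the task. -/
def optLoss (f : TwoArmedTask) : ℝ := min (f.mean 0) (f.mean 1)

/-- Law of the outcome of one round: the losses of the two arms, independent of each other. -/
def outcomeLaw (f : TwoArmedTask) : Measure (Fin 2 → ℝ) := Measure.pi f.law

instance (f : TwoArmedTask) : IsProbabilityMeasure f.outcomeLaw := by
  unfold outcomeLaw; infer_instance

/-- The heavy-tailed two-armed bandit tasks with moment exponent `1 + β = 1 / α`: losses are
nonnegative, have means in `[0, 1]`, and `E |X - μ| ^ (1 / α) ≤ 1` for both arms.
The means are bounded so that the worst-case regret over the class is at most the horizon. -/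
def heavyTailed (α : ℝ) : Set TwoArmedTask :=
  {f | ∀ a, (∀ᵐ x ∂(f.law a), 0 ≤ x) ∧ f.mean a ∈ Set.Icc (0 : ℝ) 1 ∧
    ∫⁻ x, ENNReal.ofReal (|x - f.mean a| ^ (1 / α)) ∂(f.law a) ≤ 1}

end TwoArmedTask

/-! ### Learning algorithms -/

/-- A (randomized) decision rule of an expert on two arms: an arm as a measurable function of
a random seed and of the history (the list, in chronological order, of the arms pulled and the
losses observed so far). The seed `ω : Ω` carries all internal randomization; it is drawn
independently of the outcomes. -/
structure Policy (Ω : Type) [MeasurableSpace Ω] where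
  act : Ω → List (Fin 2 × ℝ) → Fin 2
  measurable_act : ∀ n : ℕ,
    Measurable fun p : Ω × (Fin n → Fin 2 × ℝ) => act p.1 (List.ofFn p.2)

namespace Policy

variable {Ω : Type} [MeasurableSpace Ω]

/-- History after `t` rounds of a learner that is trained in every round of its own task;
`ξ s a` is the loss of arm `a` in round `s`. -/
def history (A : Policy Ω) (ω : Ω) (ξ : ℕ → Fin 2 → ℝ) : ℕ → List (Fin 2 × ℝ)
  | 0 => []
  | t + 1 =>
      A.history ω ξ t ++ [(A.act ω (A.history ω ξ t), ξ t (A.act ω (A.history ω ξ t)))]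

/-- Arm pulled in round `t` by a learner that is trained in every round. -/
def arm (A : Policy Ω) (ω : Ω) (ξ : ℕ → Fin 2 → ℝ) (t : ℕ) : Fin 2 :=
  A.act ω (A.history ω ξ t)

/-- Law of the seed and of the i.i.d. outcomes of a task. -/
def runLaw (ρ : Measure Ω) (f : TwoArmedTask) : Measure (Ω × (ℕ → Fin 2 → ℝ)) :=
  ρ.prod (Measure.infinitePi fun _ : ℕ => f.outcomeLaw)

/-- Expected regret after `T` rounds against the smallest expected loss. -/
def expectedRegret (A : Policy Ω) (ρ : Measure Ω) (f : TwoArmedTask) (T : ℕ) : ℝ :=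
  (∫ p, ∑ t ∈ Finset.range T, p.2 t (A.arm p.1 p.2 t) ∂(runLaw ρ f)) - T * f.optLoss

/-- Expected regret after `T` rounds against the arm that is best in hindsight. -/
def expectedHindsightRegret (A : Policy Ω) (ρ : Measure Ω) (f : TwoArmedTask) (T : ℕ) : ℝ :=
  ∫ p, ((∑ t ∈ Finset.range T, p.2 t (A.arm p.1 p.2 t)) -
    min (∑ t ∈ Finset.range T, p.2 t 0) (∑ t ∈ Finset.range T, p.2 t 1)) ∂(runLaw ρ f)

end Policy

/-- The family `F` admits an `α`-regret lower bound: for one constant `c > 0`, every randomized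
learner and every horizon `T ≥ 1`, the worst-case expected regret over `F` is at least `c * T ^ α`,
both for the regret against the smallest expected loss and for the regret in hindsight. -/
def HasAlphaRegretLowerBound (F : Set TwoArmedTask) (α : ℝ) : Prop :=
  ∃ c : ℝ, 0 < c ∧
    ∀ (Ω : Type) [MeasurableSpace Ω] (ρ : Measure Ω) [IsProbabilityMeasure ρ]
      (A : Policy Ω) (T : ℕ), 1 ≤ T →
      (((c * (T : ℝ) ^ α : ℝ) : EReal) ≤
        ⨆ f ∈ F, ((A.expectedRegret ρ f T : ℝ) : EReal)) ∧
      (((c * (T : ℝ) ^ α : ℝ) : EReal) ≤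
        ⨆ f ∈ F, ((A.expectedHindsightRegret ρ f T : ℝ) : EReal))

/-! ### Self-learning experts with limited advice -/

/-- What is recorded of one round: the training set `S`, the advisor `i`, the advice (an arm of
the advisor) with the loss incurred by the meta-procedure, and for every expert `k ∈ S` the arm
it pulled and its loss (`(0, 0)` stands for `k ∉ S`, whose loss is not observed). -/
abbrev RoundRecord (K : ℕ) : Type :=
  Finset (Fin K) × Fin K × (Fin 2 × ℝ) × (Fin K → Fin 2 × ℝ)

namespace RoundRecord

variable {K : ℕ}

def trained (r : RoundRecord K) : Finset (Fin K) := r.1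
def advisor (r : RoundRecord K) : Fin K := r.2.1
def advice (r : RoundRecord K) : Fin 2 := r.2.2.1.1
def incurredLoss (r : RoundRecord K) : ℝ := r.2.2.1.2
def observation (r : RoundRecord K) (k : Fin K) : Fin 2 × ℝ := r.2.2.2 k

end RoundRecord

/-- A (randomized) meta-procedure for `K` experts with per-round budget `M`: from the seed and
the records of all past rounds it selects a training set of at most `M` experts and an advisor
in it. -/
structure MetaProcedure (Ω : Type) [MeasurableSpace Ω] (K M : ℕ) where
  select : Ω → List (RoundRecord K) → Finset (Fin K) × Fin K
  card_le : ∀ ω h, (select ω h).1.card ≤ M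
  advisor_mem : ∀ ω h, (select ω h).2 ∈ (select ω h).1
  measurable_select : ∀ n : ℕ,
    Measurable fun p : Ω × (Fin n → RoundRecord K) => select p.1 (List.ofFn p.2)

/-- An expert: its learning algorithm, which maps its learning history to the arm that it pulls
when it is trained, and its advice map, which maps its learning history to the arm that it
advises. -/
structure Expert (Ω : Type) [MeasurableSpace Ω] where
  learner : Policy Ω
  advice : Policy Ω

/-- The learning history of expert `k`: its arms and losses in the rounds when it was trained. -/
def expertHistory {K : ℕ} (k : Fin K) (h : List (RoundRecord K)) : List (Fin 2 × ℝ) :=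
  (h.filter fun r => k ∈ r.trained).map fun r => r.observation k

namespace MetaProcedure

variable {Ω : Type} [MeasurableSpace Ω] {K M : ℕ}

/-- One round of the protocol after the past records `h`; `y k a` is the loss of arm `a` of
expert `k` in this round. -/
def round (P : MetaProcedure Ω K M) (E : Fin K → Expert Ω) (ω : Ω)
    (h : List (RoundRecord K)) (y : Fin K → Fin 2 → ℝ) : RoundRecord K :=
  let S : Finset (Fin K) := (P.select ω h).1
  let i : Fin K := (P.select ω h).2
  let u : Fin 2 := (E i).advice.act ω (expertHistory i h)
  let w : Fin K → Fin 2 := fun k => (E k).learner.act ω (expertHistory k h)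
  (S, i, (u, y i u), fun k => if k ∈ S then (w k, y k (w k)) else (0, 0))

/-- Records of the first `t` rounds. -/
def history (P : MetaProcedure Ω K M) (E : Fin K → Expert Ω) (ω : Ω)
    (ξ : ℕ → Fin K → Fin 2 → ℝ) : ℕ → List (RoundRecord K)
  | 0 => []
  | t + 1 => P.history E ω ξ t ++ [P.round E ω (P.history E ω ξ t) (ξ t)]

/-- Loss incurred by the meta-procedure in round `t`. -/
def loss (P : MetaProcedure Ω K M) (E : Fin K → Expert Ω) (ω : Ω)
    (ξ : ℕ → Fin K → Fin 2 → ℝ) (t : ℕ) : ℝ :=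
  (P.round E ω (P.history E ω ξ t) (ξ t)).incurredLoss

/-- Law of the seed and of the i.i.d. outcomes when expert `k` faces the task `f k`; the tasks
of different experts are independent. -/
def runLaw (ρ : Measure Ω) (f : Fin K → TwoArmedTask) :
    Measure (Ω × (ℕ → Fin K → Fin 2 → ℝ)) :=
  ρ.prod (Measure.infinitePi fun _ : ℕ => Measure.pi fun k => (f k).outcomeLaw)

/-- Expected regret of the meta-procedure after `T` rounds, against the smallest expected loss
across all experts and arms. -/
def expectedRegret (P : MetaProcedure Ω K M) (E : Fin K → Expert Ω) (ρ : Measure Ω)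
    (f : Fin K → TwoArmedTask) (T : ℕ) : ℝ :=
  ∫ p, ((∑ t ∈ Finset.range T, P.loss E p.1 p.2 t) - T * (⨅ k, (f k).optLoss)) ∂(runLaw ρ f)

end MetaProcedure

end

/-! The whole heavy-tailed class serves as the hard class. Among the `2K` arms, one hidden arm `j`
never has a loss; every other arm has, with a small probability `q`, a loss of height `v = q ^ (-α)
/ 2`, about the largest that the moment condition allows. The comparator is then `0`, and a round in
which `j` is not played costs `q * v = q ^ (1 - α) / 2` on average.

Both this environment and the null environment, where `j` has height `v` too, are driven by the same
random bits. They produce the same records until a spike of `j` is observed in the null run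
(`real_played_heights_le`). At most `M + 1` arms are observed per round, so the probabilities of
such an observation within `T` rounds, summed over `j`, are at most `q * T * (M + 1)`. With `q = K /
(4 * M * T)` this is at most `K / 2`: most choices of `j` go undetected, and some `j` costs at least
`q * v * T / 4` (`exists_le_integral_loss_heights`).

Put `x = K / (M * T)`. The bound has order `T * x ^ (1 - α)`, which equals `T ^ α * (K / M) ^ (1 -
α)` and, as `x ≤ 1` and `1 - α ≤ 1 / 2`, dominates `√(K * T / M) = T * √x`. One construction thus
yields both terms, and the case `K = M = 1` yields the regret lower bound of the class. -/

noncomputable section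

/-! ### Spike tasks -/

/-- The Bernoulli law on `Bool` with success probability `q`. -/
def boolLaw (q : unitInterval) : Measure Bool :=
  ENNReal.ofReal q • Measure.dirac true + ENNReal.ofReal (1 - q) • Measure.dirac false

instance (q : unitInterval) : IsProbabilityMeasure (boolLaw q) := by
  constructor
  simp [boolLaw, ← ENNReal.ofReal_add q.2.1 (sub_nonneg.2 q.2.2)]

lemma boolLaw_true (q : unitInterval) : boolLaw q {true} = ENNReal.ofReal q := by
  simp [boolLaw]

lemma integral_boolLaw (q : unitInterval) (g : Bool → ℝ) :
    ∫ b, g b ∂(boolLaw q) = q * g true + (1 - q) * g false := by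
  rw [integral_fintype Integrable.of_finite]
  have h1 : (boolLaw q).real {true} = q := by
    rw [measureReal_def, boolLaw_true, ENNReal.toReal_ofReal q.2.1]
  have h2 : (boolLaw q).real {false} = 1 - q := by
    have : boolLaw q {false} = ENNReal.ofReal (1 - q) := by simp [boolLaw]
    rw [measureReal_def, this, ENNReal.toReal_ofReal (sub_nonneg.2 q.2.2)]
  simp [h1, h2]

lemma lintegral_boolLaw (q : unitInterval) (g : Bool → ENNReal) :
    ∫⁻ b, g b ∂(boolLaw q) =
      ENNReal.ofReal q * g true + ENNReal.ofReal (1 - q) * g false := by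
  simp [boolLaw, lintegral_add_measure]

/-- A loss of height `c` in case of success, and no loss otherwise. -/
def spike (c : ℝ) (b : Bool) : ℝ := if b then c else 0

lemma measurable_spike (c : ℝ) : Measurable (spike c) := Measurable.of_discrete

/-- The task whose arm `a` has loss `c a` with probability `q`, and loss `0` otherwise. -/
def spikeTask (q : unitInterval) (c : Fin 2 → ℝ) : TwoArmedTask where
  law a := (boolLaw q).map (spike (c a))
  isProb a := Measure.isProbabilityMeasure_map (measurable_spike _).aemeasurable
  integrable a := by
    rw [integrable_map_measure (by fun_prop) (measurable_spike _).aemeasurable]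
    exact Integrable.of_finite

lemma spikeTask_law (q : unitInterval) (c : Fin 2 → ℝ) (a : Fin 2) :
    (spikeTask q c).law a = (boolLaw q).map (spike (c a)) := rfl

lemma spikeTask_mean (q : unitInterval) (c : Fin 2 → ℝ) (a : Fin 2) :
    (spikeTask q c).mean a = q * c a := by
  rw [TwoArmedTask.mean, spikeTask_law,
    integral_map (measurable_spike _).aemeasurable (by fun_prop), integral_boolLaw]
  simp [spike]

/-- The factor `q ^ (-α)` is calibrated so that its `1 / α`-th power cancels the probability `q`.
The factor `1 / 2` keeps the contribution of success at most `1 / 2`; the mean is also at most `1 /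
2`, which bounds the contribution of failure. -/
lemma spikeTask_mem_heavyTailed {α : ℝ} (hα : α ∈ Set.Icc (1 / 2 : ℝ) 1) (q : unitInterval)
    (hq : 0 < (q : ℝ)) {c : Fin 2 → ℝ} (hc : ∀ a, c a ∈ Set.Icc 0 ((q : ℝ) ^ (-α) / 2)) :
    spikeTask q c ∈ TwoArmedTask.heavyTailed α := by
  intro a
  obtain ⟨h0, h1⟩ := hc a
  have hα0 : 0 < α := by linarith [hα.1]
  have hp : 1 ≤ 1 / α := by rw [le_div_iff₀ hα0]; linarith [hα.2]
  have hp0 : 0 < 1 / α := by linarith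
  have hmean : (q : ℝ) * c a ≤ 1 / 2 := by
    have : (q : ℝ) * ((q : ℝ) ^ (-α) / 2) = (q : ℝ) ^ (1 - α) / 2 := by
      rw [sub_eq_add_neg, Real.rpow_add hq, Real.rpow_one]; ring
    calc (q : ℝ) * c a ≤ (q : ℝ) * ((q : ℝ) ^ (-α) / 2) := by gcongr
      _ = (q : ℝ) ^ (1 - α) / 2 := this
      _ ≤ 1 / 2 := by
        gcongr
        exact Real.rpow_le_one q.2.1 q.2.2 (by linarith [hα.2])
  have hmean0 : 0 ≤ (q : ℝ) * c a := mul_nonneg q.2.1 h0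
  have half_pow : ((1 : ℝ) / 2) ^ (1 / α) ≤ 1 / 2 := by
    simpa using Real.rpow_le_rpow_of_exponent_ge (x := (1 / 2 : ℝ)) (by norm_num) (by norm_num) hp
  refine ⟨?_, ?_, ?_⟩
  · rw [spikeTask_law, ae_map_iff (measurable_spike _).aemeasurable measurableSet_Ici]
    refine Filter.Eventually.of_forall fun b => ?_
    unfold spike; split_ifs <;> simp [h0]
  · rw [spikeTask_mean]; exact ⟨hmean0, by linarith⟩
  · rw [spikeTask_mean, spikeTask_law, lintegral_map (by fun_prop) (measurable_spike _),
      lintegral_boolLaw, ← ENNReal.ofReal_mul q.2.1,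
      ← ENNReal.ofReal_mul (sub_nonneg.2 q.2.2),
      ← ENNReal.ofReal_add (by have := q.2.1; positivity)
        (mul_nonneg (sub_nonneg.2 q.2.2) (by positivity)), ENNReal.ofReal_le_one]
    have hA : (q : ℝ) * |spike (c a) true - q * c a| ^ (1 / α) ≤ 1 / 2 := by
      have e1 : |spike (c a) true - q * c a| ≤ (q : ℝ) ^ (-α) * (1 / 2) := by
        have : (q : ℝ) * c a ≤ c a := mul_le_of_le_one_left h0 q.2.2
        simp only [spike, if_true]
        rw [abs_of_nonneg (by linarith)]; linarith
      calc (q : ℝ) * |spike (c a) true - q * c a| ^ (1 / α)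
          ≤ (q : ℝ) * ((q : ℝ) ^ (-α) * (1 / 2)) ^ (1 / α) := by gcongr
        _ = (q : ℝ) * ((q : ℝ) ^ (-1 : ℝ) * (1 / 2) ^ (1 / α)) := by
          rw [Real.mul_rpow (by positivity) (by norm_num), ← Real.rpow_mul q.2.1]
          congr 3; field_simp
        _ = (1 / 2) ^ (1 / α) := by
          rw [Real.rpow_neg_one, ← mul_assoc, mul_inv_cancel₀ hq.ne', one_mul]
        _ ≤ 1 / 2 := half_pow
    have hB : (1 - (q : ℝ)) * |spike (c a) false - q * c a| ^ (1 / α) ≤ 1 / 2 := by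
      have e1 : |spike (c a) false - q * c a| ≤ 1 / 2 := by
        simp only [spike, Bool.false_eq_true, if_false, zero_sub, abs_neg]
        rwa [abs_of_nonneg hmean0]
      calc (1 - (q : ℝ)) * |spike (c a) false - q * c a| ^ (1 / α)
          ≤ 1 * (1 / 2) ^ (1 / α) := by
            gcongr
            linarith
        _ ≤ 1 / 2 := by linarith
    linarith

/-! ### Events that depend on finitely many coordinates -/

section Coordinates

variable {β : Type} [Finite β] [Nonempty β] [MeasurableSpace β] [MeasurableSingletonClass β]

/-- Only finitely many values of the first `t` coordinates are possible, so joint measurability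
reduces to measurability in the seed for each of them. The later coordinates are filled in
arbitrarily. -/
lemma measurable_prod_of_dependsOn {Ω γ : Type*} [MeasurableSpace Ω] [MeasurableSpace γ] {t : ℕ}
    {f : Ω × (ℕ → β) → γ} (hf : ∀ b, Measurable fun ω => f (ω, b))
    (hdep : ∀ ω, DependsOn (fun b => f (ω, b)) (Set.Iio t)) : Measurable f := by
  classical
  let ext (r : Fin t → β) (s : ℕ) : β := if h : s < t then r ⟨s, h⟩ else Classical.arbitrary β
  have hF : Measurable fun p : Ω × (Fin t → β) => f (p.1, ext p.2) :=
    measurable_from_prod_countable_left fun r => hf (ext r)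
  have hg : Measurable fun p : Ω × (ℕ → β) => (p.1, fun s : Fin t => p.2 s) := by fun_prop
  convert hF.comp hg using 1
  funext p
  refine hdep p.1 fun s hs => ?_
  simp only [Set.mem_Iio] at hs
  simp [ext, hs]

lemma measurable_of_dependsOn {γ : Type*} [MeasurableSpace γ] {t : ℕ} {f : (ℕ → β) → γ}
    (hdep : DependsOn f (Set.Iio t)) : Measurable f :=
  (measurable_prod_of_dependsOn (Ω := Unit) (f := fun p => f p.2)
    (fun b => measurable_const (a := f b)) fun _ => hdep).comp (measurable_const.prodMk measurable_id : Measurable fun b => ((), b))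

lemma measurableSet_of_dependsOn {t : ℕ} {A : (ℕ → β) → Prop} (hdep : DependsOn A (Set.Iio t)) :
    MeasurableSet {b | A b} :=
  measurableSet_setOfPred.2 (measurable_of_dependsOn hdep)

/-- An event of the past is independent of the present coordinate. -/
lemma infinitePi_past_inter_present (π : Measure β) [IsProbabilityMeasure π] {t : ℕ}
    {A : (ℕ → β) → Prop} (hdep : DependsOn A (Set.Iio t)) (B : Set β) :
    (Measure.infinitePi fun _ : ℕ => π) {b | A b ∧ b t ∈ B} =
      (Measure.infinitePi fun _ : ℕ => π) {b | A b} * π B := by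
  classical
  have hind := (ProbabilityTheory.iIndepFun_infinitePi (P := fun _ : ℕ => π)
    (X := fun _ x => x) (fun _ => measurable_id)).indepFun_finset
      (Finset.range t) {t} (by simp) (fun i => by fun_prop)
  let ext (r : Finset.range t → β) (s : ℕ) : β :=
    if h : s ∈ Finset.range t then r ⟨s, h⟩ else Classical.arbitrary β
  have hA : {b : ℕ → β | A b} =
      (fun (b : ℕ → β) (s : Finset.range t) => b s) ⁻¹' {r | A (ext r)} := by
    ext b
    simp only [Set.mem_ofPred_eq, Set.mem_preimage]
    refine iff_of_eq (hdep fun s hs => ?_)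
    have : s ∈ Finset.range t := by simpa using hs
    simp only [ext, this, dite_true]
  have hB : {b : ℕ → β | b t ∈ B} =
      (fun (b : ℕ → β) (s : ({t} : Finset ℕ)) => b s) ⁻¹' {r | r ⟨t, by simp⟩ ∈ B} := rfl
  have hBm : MeasurableSet B := B.toFinite.measurableSet
  have hπ : (Measure.infinitePi fun _ : ℕ => π) {b | b t ∈ B} = π B :=
    (measurePreserving_eval_infinitePi (fun _ : ℕ => π) t).measure_preimage
      hBm.nullMeasurableSet
  have := hind.measure_inter_preimage_eq_mul {r | A (ext r)} {r | r ⟨t, by simp⟩ ∈ B}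
    (Set.toFinite _).measurableSet (Set.toFinite _).measurableSet
  rw [← hA, ← hB, hπ] at this
  exact this

end Coordinates

/-! ### The protocol for a fixed seed -/

namespace MetaProcedure

variable {Ω : Type} [MeasurableSpace Ω] {K M : ℕ}

/-- The arm that the meta-procedure plays after the past records `h`. -/
def decision (P : MetaProcedure Ω K M) (E : Fin K → Expert Ω) (ω : Ω)
    (h : List (RoundRecord K)) : Fin K × Fin 2 :=
  ((P.select ω h).2,
    (E (P.select ω h).2).advice.act ω (expertHistory (P.select ω h).2 h))

/-- The arms whose losses are observed after the past records `h`. -/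
def observed (P : MetaProcedure Ω K M) (E : Fin K → Expert Ω) (ω : Ω)
    (h : List (RoundRecord K)) : Finset (Fin K × Fin 2) :=
  insert (P.decision E ω h)
    ((P.select ω h).1.image fun k => (k, (E k).learner.act ω (expertHistory k h)))

/-- The extra `1` is needed because the advised arm may differ from the arm that the advisor's
learning algorithm pulls. -/
lemma card_observed_le (P : MetaProcedure Ω K M) (E : Fin K → Expert Ω) (ω : Ω)
    (h : List (RoundRecord K)) : (P.observed E ω h).card ≤ M + 1 :=
  (Finset.card_insert_le _ _).trans
    (Nat.succ_le_succ (Finset.card_image_le.trans (P.card_le ω h)))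

lemma round_congr (P : MetaProcedure Ω K M) (E : Fin K → Expert Ω) (ω : Ω)
    (h : List (RoundRecord K)) {y y' : Fin K → Fin 2 → ℝ}
    (hy : ∀ j ∈ P.observed E ω h, y j.1 j.2 = y' j.1 j.2) :
    P.round E ω h y = P.round E ω h y' := by
  have h1 := hy (P.decision E ω h) (Finset.mem_insert_self _ _)
  have h2 : ∀ k ∈ (P.select ω h).1, y k ((E k).learner.act ω (expertHistory k h)) =
      y' k ((E k).learner.act ω (expertHistory k h)) := fun k hk =>
    hy (k, _) (Finset.mem_insert_of_mem (Finset.mem_image_of_mem _ hk))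
  simp only [decision] at h1
  simp only [round, h1]
  congr 3
  funext k
  split_ifs with hk
  · rw [h2 k hk]
  · rfl

lemma loss_eq (P : MetaProcedure Ω K M) (E : Fin K → Expert Ω) (ω : Ω)
    (ξ : ℕ → Fin K → Fin 2 → ℝ) (t : ℕ) :
    P.loss E ω ξ t = ξ t (P.decision E ω (P.history E ω ξ t)).1
      (P.decision E ω (P.history E ω ξ t)).2 := rfl

/-- This carries the coupling: agreement is required only at the arms observed along the run on `ξ`,
so a change of environment stays invisible until an altered loss is seen there. -/
lemma history_congr (P : MetaProcedure Ω K M) (E : Fin K → Expert Ω) (ω : Ω)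
    {ξ ξ' : ℕ → Fin K → Fin 2 → ℝ} {t : ℕ}
    (hξ : ∀ s < t, ∀ j ∈ P.observed E ω (P.history E ω ξ s), ξ s j.1 j.2 = ξ' s j.1 j.2) :
    P.history E ω ξ t = P.history E ω ξ' t := by
  induction t with
  | zero => rfl
  | succ t ih =>
    have := ih fun s hs => hξ s (hs.trans t.lt_succ_self)
    simp only [history, ← this]
    rw [P.round_congr E ω _ (hξ t t.lt_succ_self)]

lemma dependsOn_history (P : MetaProcedure Ω K M) (E : Fin K → Expert Ω) (ω : Ω) (t : ℕ) :
    DependsOn (fun ξ => P.history E ω ξ t) (Set.Iio t) :=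
  fun _ _ h => P.history_congr E ω fun s hs j _ => by rw [h s hs]

/-! ### Measurability in the seed -/

lemma measurable_select_list (P : MetaProcedure Ω K M) (h : List (RoundRecord K)) :
    Measurable fun ω => P.select ω h := by
  have := (P.measurable_select h.length).comp
    (measurable_id.prodMk measurable_const : Measurable fun ω : Ω => (ω, h.get))
  simpa [Function.comp_def] using this

end MetaProcedure

lemma Policy.measurable_act_list {Ω : Type} [MeasurableSpace Ω] (A : Policy Ω)
    (h : List (Fin 2 × ℝ)) : Measurable fun ω => A.act ω h := by
  have := (A.measurable_act h.length).comp
    (measurable_id.prodMk measurable_const : Measurable fun ω : Ω => (ω, h.get))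
  simpa [Function.comp_def] using this

/-- A measurable function into a finite discrete space as a simple function. -/
def simpleFuncOfFinite {Ω γ : Type*} [MeasurableSpace Ω] [Finite γ] [MeasurableSpace γ]
    [MeasurableSingletonClass γ] (f : Ω → γ) (hf : Measurable f) : SimpleFunc Ω γ :=
  ⟨f, fun c => hf (measurableSet_singleton c), Set.toFinite _⟩

namespace MetaProcedure

variable {Ω : Type} [MeasurableSpace Ω] {K M : ℕ}

/-- For fixed losses, the seed influences a round through finitely many choices. Simple functions
express this without a σ-algebra on lists of records, and they compose by `SimpleFunc.bind`. -/
lemma exists_simpleFunc_round (P : MetaProcedure Ω K M) (E : Fin K → Expert Ω)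
    (h : List (RoundRecord K)) (y : Fin K → Fin 2 → ℝ) :
    ∃ g : SimpleFunc Ω (RoundRecord K), ∀ ω, g ω = P.round E ω h y := by
  let sel : SimpleFunc Ω (Finset (Fin K) × Fin K) :=
    simpleFuncOfFinite _ (P.measurable_select_list h)
  let adv : SimpleFunc Ω (Fin K → Fin 2) :=
    simpleFuncOfFinite (fun ω k => (E k).advice.act ω (expertHistory k h))
      (measurable_pi_lambda _ fun k => (E k).advice.measurable_act_list _)
  let lea : SimpleFunc Ω (Fin K → Fin 2) :=
    simpleFuncOfFinite (fun ω k => (E k).learner.act ω (expertHistory k h))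
      (measurable_pi_lambda _ fun k => (E k).learner.measurable_act_list _)
  exact ⟨((sel.pair (adv.pair lea))).map fun p =>
    (p.1.1, p.1.2, (p.2.1 p.1.2, y p.1.2 (p.2.1 p.1.2)),
      fun k => if k ∈ p.1.1 then (p.2.2 k, y k (p.2.2 k)) else (0, 0)), fun ω => rfl⟩

lemma exists_simpleFunc_history (P : MetaProcedure Ω K M) (E : Fin K → Expert Ω)
    (ξ : ℕ → Fin K → Fin 2 → ℝ) (t : ℕ) :
    ∃ g : SimpleFunc Ω (List (RoundRecord K)), ∀ ω, g ω = P.history E ω ξ t := by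
  induction t with
  | zero => exact ⟨SimpleFunc.const _ [], fun _ => rfl⟩
  | succ t ih =>
    obtain ⟨g, hg⟩ := ih
    choose r hr using fun h => P.exists_simpleFunc_round E h (ξ t)
    exact ⟨g.bind fun h => (r h).map fun x => h ++ [x], fun ω => by
      simp [SimpleFunc.bind_apply, hr, hg, history]⟩

lemma measurable_loss_seed (P : MetaProcedure Ω K M) (E : Fin K → Expert Ω)
    (ξ : ℕ → Fin K → Fin 2 → ℝ) (t : ℕ) : Measurable fun ω => P.loss E ω ξ t := by
  choose r hr using fun h => P.exists_simpleFunc_round E h (ξ t)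
  obtain ⟨g, hg⟩ := P.exists_simpleFunc_history E ξ t
  convert (((g.bind r).map RoundRecord.incurredLoss).measurable) using 2 with ω
  simp [hr, hg, loss]

end MetaProcedure

/-! ### The law of the losses as an image of random bits -/

/-- The law of one bit for each arm of each expert. -/
def roundBitsLaw (q : unitInterval) (K : ℕ) : Measure (Fin K → Fin 2 → Bool) :=
  Measure.pi fun _ => Measure.pi fun _ => boolLaw q

instance (q : unitInterval) (K : ℕ) : IsProbabilityMeasure (roundBitsLaw q K) := by
  unfold roundBitsLaw; infer_instance

lemma roundBitsLaw_eval (q : unitInterval) {K : ℕ} (j : Fin K × Fin 2) :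
    roundBitsLaw q K {y | y j.1 j.2 = true} = ENNReal.ofReal q := by
  have := ((measurePreserving_eval (fun _ : Fin 2 => boolLaw q) j.2).comp
    (measurePreserving_eval (fun _ : Fin K => Measure.pi fun _ : Fin 2 => boolLaw q) j.1))
  rw [← boolLaw_true, ← this.measure_preimage (measurableSet_singleton _).nullMeasurableSet]
  rfl

/-- The law of the bits of all rounds. -/
def bitsLaw (q : unitInterval) (K : ℕ) : Measure (ℕ → Fin K → Fin 2 → Bool) :=
  Measure.infinitePi fun _ => roundBitsLaw q K

instance (q : unitInterval) (K : ℕ) : IsProbabilityMeasure (bitsLaw q K) := by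
  unfold bitsLaw; infer_instance

/-- The losses with heights `c` that are encoded by the bits `b`. -/
def spikeLosses {K : ℕ} (c : Fin K → Fin 2 → ℝ) (b : ℕ → Fin K → Fin 2 → Bool) :
    ℕ → Fin K → Fin 2 → ℝ :=
  fun t k a => spike (c k a) (b t k a)

lemma measurable_spikeLosses {K : ℕ} (c : Fin K → Fin 2 → ℝ) : Measurable (spikeLosses c) :=
  measurable_pi_lambda _ fun t => measurable_pi_lambda _ fun k => measurable_pi_lambda _ fun a =>
    (measurable_spike _).comp (by fun_prop : Measurable fun b : ℕ → Fin K → Fin 2 → Bool => b t k a)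

namespace MetaProcedure

variable {Ω : Type} [MeasurableSpace Ω] {K M : ℕ}

lemma runLaw_spikeTask (ρ : Measure Ω) [IsProbabilityMeasure ρ] (q : unitInterval)
    (c : Fin K → Fin 2 → ℝ) :
    runLaw ρ (fun k => spikeTask q (c k)) =
      (ρ.prod (bitsLaw q K)).map (Prod.map id (spikeLosses c)) := by
  have hk (k : Fin K) : (spikeTask q (c k)).outcomeLaw =
      (Measure.pi fun _ : Fin 2 => boolLaw q).map fun y a => spike (c k a) (y a) := by
    have (a : Fin 2) : IsProbabilityMeasure ((boolLaw q).map (spike (c k a))) :=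
      Measure.isProbabilityMeasure_map (measurable_spike _).aemeasurable
    exact (Measure.pi_map_pi (fun a => (measurable_spike (c k a)).aemeasurable)).symm
  have hround : (Measure.pi fun k => (spikeTask q (c k)).outcomeLaw) =
      (roundBitsLaw q K).map fun y k a => spike (c k a) (y k a) := by
    simp_rw [hk]
    have (k : Fin K) : IsProbabilityMeasure
        ((Measure.pi fun _ : Fin 2 => boolLaw q).map fun y a => spike (c k a) (y a)) :=
      hk k ▸ inferInstance
    exact (Measure.pi_map_pi (f := fun k (y : Fin 2 → Bool) a => spike (c k a) (y a))
      (fun k => (Measurable.of_discrete).aemeasurable)).symm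
  have hinf : (Measure.infinitePi fun _ : ℕ => Measure.pi fun k => (spikeTask q (c k)).outcomeLaw) =
      (bitsLaw q K).map (spikeLosses c) := by
    simp_rw [hround]
    exact (Measure.infinitePi_map_pi (fun _ : ℕ => roundBitsLaw q K)
      (f := fun _ y k a => spike (c k a) (y k a)) (fun _ => Measurable.of_discrete)).symm
  rw [runLaw, hinf, ← Measure.map_prod_map _ _ measurable_id (measurable_spikeLosses c),
    Measure.map_id]

/-- Under the law of spike tasks the losses are a.s. functions of the bits that they determine. -/
lemma integral_runLaw_spikeTask (ρ : Measure Ω) [IsProbabilityMeasure ρ] (q : unitInterval)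
    (c : Fin K → Fin 2 → ℝ) (g : Ω × (ℕ → Fin K → Fin 2 → ℝ) → ℝ)
    (hg : Measurable fun p : Ω × (ℕ → Fin K → Fin 2 → Bool) => g (p.1, spikeLosses c p.2)) :
    ∫ p, g p ∂(runLaw ρ fun k => spikeTask q (c k)) =
      ∫ p, g (p.1, spikeLosses c p.2) ∂(ρ.prod (bitsLaw q K)) := by
  have hΦ : Measurable (Prod.map id (spikeLosses c) : Ω × _ → Ω × _) :=
    measurable_id.prodMap (measurable_spikeLosses c)
  -- Measurability of `g` is known only along encoded bits. Decoding bits from losses gives a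
  -- measurable function that agrees with `g` almost everywhere. An arm of height `0` loses its
  -- bits, but encoding again still returns the same losses.
  let bit (x : ℝ) : Bool := decide (x ≠ 0)
  have hbit : Measurable bit :=
    measurable_to_bool (by
      have : bit ⁻¹' {true} = {0}ᶜ := by ext x; simp [bit]
      rw [this]; exact (measurableSet_singleton 0).compl)
  let enc (ξ : ℕ → Fin K → Fin 2 → ℝ) : ℕ → Fin K → Fin 2 → Bool := fun t k a => bit (ξ t k a)
  have henc : Measurable enc :=
    measurable_pi_lambda _ fun t => measurable_pi_lambda _ fun k => measurable_pi_lambda _ fun a =>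
      hbit.comp (by fun_prop : Measurable fun ξ : ℕ → Fin K → Fin 2 → ℝ => ξ t k a)
  have hretract : ∀ b, spikeLosses c (enc (spikeLosses c b)) = spikeLosses c b := by
    intro b
    funext t k a
    simp only [spikeLosses, enc, bit, spike]
    split_ifs <;> simp_all
  have hset : MeasurableSet {p : Ω × (ℕ → Fin K → Fin 2 → ℝ) | spikeLosses c (enc p.2) = p.2} :=
    measurableSet_eq_fun ((measurable_spikeLosses c).comp (henc.comp measurable_snd))
      measurable_snd
  rw [runLaw_spikeTask]
  refine integral_map hΦ.aemeasurable (Measurable.aestronglyMeasurable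
    (hg.comp (measurable_fst.prodMk (henc.comp measurable_snd))) |>.congr ?_)
  refine ((ae_map_iff hΦ.aemeasurable hset).2 (Filter.Eventually.of_forall fun p => ?_)).mono
    fun p hp => ?_
  · exact hretract p.2
  · change g (p.1, spikeLosses c (enc p.2)) = g p
    rw [hp]

lemma dependsOn_history_spikeLosses (P : MetaProcedure Ω K M) (E : Fin K → Expert Ω) (ω : Ω)
    (c : Fin K → Fin 2 → ℝ) (t : ℕ) :
    DependsOn (fun b => P.history E ω (spikeLosses c b) t) (Set.Iio t) := fun b b' h =>
  P.dependsOn_history E ω t fun s hs => by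
    funext k a
    simp only [spikeLosses, h s hs]

lemma measurable_loss_spikeLosses (P : MetaProcedure Ω K M) (E : Fin K → Expert Ω)
    (c : Fin K → Fin 2 → ℝ) (t : ℕ) :
    Measurable fun p : Ω × (ℕ → Fin K → Fin 2 → Bool) => P.loss E p.1 (spikeLosses c p.2) t := by
  -- The decision uses only the bits before `t`, whereas the incurred loss also reads those of round
  -- `t`; hence `t + 1`.
  refine measurable_prod_of_dependsOn (t := t + 1) (fun b => P.measurable_loss_seed E (spikeLosses c b) t)
    fun ω b b' h => ?_
  have hh := P.dependsOn_history_spikeLosses E ω c t fun s hs =>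
    h s (Set.mem_Iio.2 ((Set.mem_Iio.1 hs).trans t.lt_succ_self))
  simp only [loss_eq] at hh ⊢
  rw [hh]
  simp only [spikeLosses, h t (Set.mem_Iio.2 t.lt_succ_self)]

/-! ### The lower bound for a fixed seed -/

section FixedSeed

variable (P : MetaProcedure Ω K M) (E : Fin K → Expert Ω) (ω : Ω) (q : unitInterval)

/-- The arm played in round `t`, as a function of the bits. -/
def played (c : Fin K → Fin 2 → ℝ) (t : ℕ) (b : ℕ → Fin K → Fin 2 → Bool) : Fin K × Fin 2 :=
  P.decision E ω (P.history E ω (spikeLosses c b) t)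

/-- The arms observed in round `t`, as a function of the bits. -/
def seen (c : Fin K → Fin 2 → ℝ) (t : ℕ) (b : ℕ → Fin K → Fin 2 → Bool) :
    Finset (Fin K × Fin 2) :=
  P.observed E ω (P.history E ω (spikeLosses c b) t)

lemma dependsOn_played (c : Fin K → Fin 2 → ℝ) (t : ℕ) (j : Fin K × Fin 2) :
    DependsOn (fun b => P.played E ω c t b = j) (Set.Iio t) := fun b b' h => by
  have := P.dependsOn_history_spikeLosses E ω c t h
  simp only at this
  simp only [played, this]

lemma dependsOn_seen (c : Fin K → Fin 2 → ℝ) (t : ℕ) (j : Fin K × Fin 2) :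
    DependsOn (fun b => j ∈ P.seen E ω c t b) (Set.Iio t) := fun b b' h => by
  have := P.dependsOn_history_spikeLosses E ω c t h
  simp only at this
  simp only [seen, this]

lemma bitsLaw_past_inter_bit {t : ℕ} {A : (ℕ → Fin K → Fin 2 → Bool) → Prop}
    (hA : DependsOn A (Set.Iio t)) (j : Fin K × Fin 2) :
    (bitsLaw q K).real {b | A b ∧ b t j.1 j.2 = true} = q * (bitsLaw q K).real {b | A b} := by
  have := infinitePi_past_inter_present (roundBitsLaw q K) hA {y | y j.1 j.2 = true}
  rw [roundBitsLaw_eval] at this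
  have := congrArg ENNReal.toReal this
  rw [ENNReal.toReal_mul, ENNReal.toReal_ofReal q.2.1, mul_comm] at this
  exact this

lemma sum_real_played (c : Fin K → Fin 2 → ℝ) (t : ℕ) :
    ∑ j, (bitsLaw q K).real {b | P.played E ω c t b = j} = 1 := by
  have h := measureReal_biUnion_finset (μ := bitsLaw q K) (s := Finset.univ)
    (f := fun j => {b | P.played E ω c t b = j})
    (fun i _ j _ hij => Set.disjoint_left.2 fun b hi hj => hij (hi.symm.trans hj))
    (fun j _ => measurableSet_of_dependsOn (P.dependsOn_played E ω c t j))
  rw [← h]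
  convert probReal_univ (μ := bitsLaw q K)
  ext b; simp

lemma sum_real_seen_le (c : Fin K → Fin 2 → ℝ) (t : ℕ) :
    ∑ j, (bitsLaw q K).real {b | j ∈ P.seen E ω c t b} ≤ M + 1 := by
  have hm (j : Fin K × Fin 2) : MeasurableSet {b | j ∈ P.seen E ω c t b} :=
    measurableSet_of_dependsOn (P.dependsOn_seen E ω c t j)
  have hi (j : Fin K × Fin 2) : Integrable
      ({b | j ∈ P.seen E ω c t b}.indicator fun _ => (1 : ℝ)) (bitsLaw q K) :=
    (integrable_const 1).indicator (hm j)
  calc ∑ j, (bitsLaw q K).real {b | j ∈ P.seen E ω c t b}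
      = ∑ j, ∫ b, {b | j ∈ P.seen E ω c t b}.indicator (fun _ => (1 : ℝ)) b ∂(bitsLaw q K) := by
        refine Finset.sum_congr rfl fun j _ => ?_
        rw [integral_indicator_const _ (hm j), smul_eq_mul, mul_one]
    _ = ∫ b, ∑ j, {b | j ∈ P.seen E ω c t b}.indicator (fun _ => (1 : ℝ)) b ∂(bitsLaw q K) :=
        (integral_finsetSum _ fun j _ => hi j).symm
    _ ≤ ∫ _, ((M : ℝ) + 1) ∂(bitsLaw q K) := by
        refine integral_mono (integrable_finsetSum _ fun j _ => hi j) (integrable_const _)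
          fun b => ?_
        have : ∑ j, {b | j ∈ P.seen E ω c t b}.indicator (fun _ => (1 : ℝ)) b =
            (P.seen E ω c t b).card := by
          simp [Set.indicator_apply]
        simp only [this]
        exact_mod_cast P.card_observed_le E ω _
    _ = M + 1 := by simp

lemma integral_loss_spikeLosses (c : Fin K → Fin 2 → ℝ) (t : ℕ) :
    ∫ b, P.loss E ω (spikeLosses c b) t ∂(bitsLaw q K) =
      q * ∑ j : Fin K × Fin 2, c j.1 j.2 * (bitsLaw q K).real {b | P.played E ω c t b = j} := by
  have hm (j : Fin K × Fin 2) :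
      MeasurableSet {b | P.played E ω c t b = j ∧ b t j.1 j.2 = true} := by
    refine (measurableSet_of_dependsOn (P.dependsOn_played E ω c t j)).inter ?_
    exact (measurableSet_singleton true).preimage
      (by fun_prop : Measurable fun b : ℕ → Fin K → Fin 2 → Bool => b t j.1 j.2)
  have hloss (b : ℕ → Fin K → Fin 2 → Bool) : P.loss E ω (spikeLosses c b) t =
      ∑ j, {b | P.played E ω c t b = j ∧ b t j.1 j.2 = true}.indicator
        (fun _ => c j.1 j.2) b := by
    rw [Finset.sum_eq_single (P.played E ω c t b)]
    · simp [loss_eq, spikeLosses, spike, played, Set.indicator_apply]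
    · intro j _ hj
      exact Set.indicator_of_notMem (fun h => hj h.1.symm) _
    · simp
  simp_rw [hloss]
  rw [integral_finsetSum _ fun j _ => (integrable_const _).indicator (hm j), Finset.mul_sum]
  refine Finset.sum_congr rfl fun j _ => ?_
  rw [integral_indicator_const _ (hm j), bitsLaw_past_inter_bit q (P.dependsOn_played E ω c t j)]
  simp only [smul_eq_mul]; ring

/-- The heights of the environment in which the arm `j` has no loss and every other arm has
height `v`. -/
def heights (v : ℝ) (j : Fin K × Fin 2) : Fin K → Fin 2 → ℝ :=
  fun k a => if (k, a) = j then 0 else v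

lemma integral_loss_heights (v : ℝ) (j : Fin K × Fin 2) (t : ℕ) :
    ∫ b, P.loss E ω (spikeLosses (heights v j) b) t ∂(bitsLaw q K) =
      q * v * (1 - (bitsLaw q K).real {b | P.played E ω (heights v j) t b = j}) := by
  rw [integral_loss_spikeLosses, ← P.sum_real_played E ω q (heights v j) t, mul_assoc, mul_sub]
  congr 1
  rw [Finset.mul_sum]
  rw [eq_sub_iff_add_eq, ← Finset.sum_erase_add _ _ (Finset.mem_univ j),
    ← Finset.sum_erase_add _ _ (Finset.mem_univ j)]
  simp only [heights, Prod.mk.eta, if_true, zero_mul, add_zero]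
  congr 1
  refine Finset.sum_congr rfl fun i hi => ?_
  rw [if_neg (Finset.ne_of_mem_erase hi)]

/-- The environment without losses of the arm `j` can be told from the one in which all arms
have the same law only by observing a loss of the arm `j`. -/
lemma real_played_heights_le (v : ℝ) (j : Fin K × Fin 2) (t : ℕ) :
    (bitsLaw q K).real {b | P.played E ω (heights v j) t b = j} ≤
      (bitsLaw q K).real {b | P.played E ω (fun _ _ => v) t b = j} +
        ∑ s ∈ Finset.range t, q * (bitsLaw q K).real {b | j ∈ P.seen E ω (fun _ _ => v) s b} := by
  have hsub : {b | P.played E ω (heights v j) t b = j} ⊆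
      {b | P.played E ω (fun _ _ => v) t b = j} ∪ ⋃ s ∈ Finset.range t,
        {b | j ∈ P.seen E ω (fun _ _ => v) s b ∧ b s j.1 j.2 = true} := by
    intro b hb
    -- If the null run has seen no spike of `j` before `t`, every loss it has observed is the same
    -- in both environments, so the two runs coincide up to `t`.
    by_cases h : ∃ s < t, j ∈ P.seen E ω (fun _ _ => v) s b ∧ b s j.1 j.2 = true
    · obtain ⟨s, hs, h⟩ := h
      exact Or.inr (Set.mem_biUnion (Finset.mem_range.2 hs) h)
    · push Not at h
      left
      have : P.history E ω (spikeLosses (fun _ _ => v) b) t =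
          P.history E ω (spikeLosses (heights v j) b) t := by
        refine P.history_congr E ω fun s hs i hi => ?_
        by_cases hij : i = j
        · subst hij
          have := h s hs hi
          simp [spikeLosses, spike, this]
        · simp [spikeLosses, heights, hij]
      change P.decision E ω _ = j
      rw [this]
      exact hb
  refine (measureReal_mono hsub).trans ((measureReal_union_le _ _).trans ?_)
  gcongr
  refine (measureReal_biUnion_finset_le _ _).trans_eq ?_
  exact Finset.sum_congr rfl fun s _ => bitsLaw_past_inter_bit q (P.dependsOn_seen E ω _ s j) j

/-- The null run is common to all `j`. Its probabilities of playing `j` therefore add up to `1`, and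
its probabilities of observing `j` to at most `M + 1` per round. -/
lemma le_sum_integral_loss_heights {v : ℝ} (hv : 0 ≤ v) {t T : ℕ} (ht : t ≤ T) :
    q * v * (2 * K - 1 - q * T * (M + 1)) ≤
      ∑ j, ∫ b, P.loss E ω (spikeLosses (heights v j) b) t ∂(bitsLaw q K) := by
  simp_rw [integral_loss_heights]
  rw [← Finset.mul_sum]
  have hq := q.2.1
  gcongr
  rw [Finset.sum_sub_distrib]
  have h1 := Finset.sum_le_sum fun j (_ : j ∈ Finset.univ) =>
    P.real_played_heights_le E ω q v j t
  rw [Finset.sum_add_distrib, sum_real_played, Finset.sum_comm] at h1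
  have h2 : ∑ s ∈ Finset.range t, ∑ j,
      (q : ℝ) * (bitsLaw q K).real {b | j ∈ P.seen E ω (fun _ _ => v) s b} ≤ q * T * (M + 1) := by
    calc _ ≤ ∑ s ∈ Finset.range t, (q : ℝ) * (M + 1) := by
          refine Finset.sum_le_sum fun s _ => ?_
          rw [← Finset.mul_sum]
          gcongr
          exact P.sum_real_seen_le E ω q _ s
      _ = q * t * (M + 1) := by simp; ring
      _ ≤ q * T * (M + 1) := by gcongr
  have h3 : ∑ _j : Fin K × Fin 2, (1 : ℝ) = 2 * K := by simp; ring
  linarith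

end FixedSeed

end MetaProcedure

/-! ### Averaging over the seed -/

lemma spikeLosses_heights_mem_Icc {K : ℕ} {v : ℝ} (hv : 0 ≤ v) (j : Fin K × Fin 2)
    (b : ℕ → Fin K → Fin 2 → Bool) (t : ℕ) (k : Fin K) (a : Fin 2) :
    spikeLosses (MetaProcedure.heights v j) b t k a ∈ Set.Icc 0 v := by
  simp only [spikeLosses, spike, MetaProcedure.heights]
  split_ifs <;> simp [hv]

namespace MetaProcedure

variable {Ω : Type} [MeasurableSpace Ω] {K M : ℕ}

lemma integrable_loss_heights (P : MetaProcedure Ω K M) (E : Fin K → Expert Ω) (ρ : Measure Ω)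
    [IsProbabilityMeasure ρ] (q : unitInterval) {v : ℝ} (hv : 0 ≤ v) (j : Fin K × Fin 2) (t : ℕ) :
    Integrable (fun p => P.loss E p.1 (spikeLosses (heights v j) p.2) t)
      (ρ.prod (bitsLaw q K)) := by
  refine Integrable.of_bound (P.measurable_loss_spikeLosses E _ t).aestronglyMeasurable v
    (Filter.Eventually.of_forall fun p => ?_)
  have := spikeLosses_heights_mem_Icc hv j p.2 t
    (P.decision E p.1 (P.history E p.1 (spikeLosses (heights v j) p.2) t)).1
    (P.decision E p.1 (P.history E p.1 (spikeLosses (heights v j) p.2) t)).2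
  rw [loss_eq, Real.norm_eq_abs, abs_of_nonneg this.1]
  exact this.2

/-- A single `j` must work for all rounds and seeds, so averaging over `j` comes after summing over
rounds and integrating out the seed. The constant is `(K / 2) / (2 * K) = 1 / 4`. -/
lemma exists_le_integral_loss_heights (P : MetaProcedure Ω K M) (E : Fin K → Expert Ω)
    (ρ : Measure Ω) [IsProbabilityMeasure ρ] (q : unitInterval) {v : ℝ} (hv : 0 ≤ v) {T : ℕ}
    (hK : 1 ≤ K) (hq : (q : ℝ) * T * (M + 1) ≤ K / 2) :
    ∃ j : Fin K × Fin 2, q * v * T / 4 ≤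
      ∫ p, ∑ t ∈ Finset.range T, P.loss E p.1 (spikeLosses (heights v j) p.2) t
        ∂(ρ.prod (bitsLaw q K)) := by
  have hint := P.integrable_loss_heights E ρ q hv
  have hK' : (1 : ℝ) ≤ K := by exact_mod_cast hK
  have hseed (t : ℕ) (ht : t ∈ Finset.range T) : q * v * (K / 2) ≤
      ∑ j, ∫ p, P.loss E p.1 (spikeLosses (heights v j) p.2) t ∂(ρ.prod (bitsLaw q K)) := by
    simp_rw [fun j => integral_prod _ (hint j t)]
    rw [← integral_finsetSum _ fun j _ => (hint j t).integral_prod_left]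
    calc q * v * (K / 2) = ∫ _, q * v * (K / 2) ∂ρ := by simp
      _ ≤ _ := by
        refine integral_mono (integrable_const _)
          (integrable_finsetSum _ fun j _ => (hint j t).integral_prod_left) fun ω => ?_
        -- It remains that `2 * K - 1 - K / 2 ≥ K / 2`, which is where `K ≥ 1` enters.
        refine le_trans ?_ (P.le_sum_integral_loss_heights E ω q hv (Finset.mem_range.1 ht).le)
        have := q.2.1
        gcongr
        linarith
  have hsum : ∑ _j : Fin K × Fin 2, q * v * T / 4 ≤ ∑ j : Fin K × Fin 2,
      ∫ p, ∑ t ∈ Finset.range T, P.loss E p.1 (spikeLosses (heights v j) p.2) t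
        ∂(ρ.prod (bitsLaw q K)) := by
    simp_rw [fun j => integral_finsetSum (Finset.range T) fun t _ => hint j t]
    rw [Finset.sum_comm]
    refine le_trans (le_of_eq ?_) (Finset.sum_le_sum hseed)
    simp; ring
  obtain ⟨j, -, hj⟩ := Finset.exists_le_of_sum_le ⟨(⟨0, hK⟩, 0), Finset.mem_univ _⟩ hsum
  exact ⟨j, hj⟩

/-- For `K ≤ M T` some spike tasks, one of them with an arm without losses, make the cumulative
loss large. -/
lemma exists_spikeTask_le_integral_loss (P : MetaProcedure Ω K M) (E : Fin K → Expert Ω)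
    (ρ : Measure Ω) [IsProbabilityMeasure ρ] {α : ℝ} (hα : α ∈ Set.Icc (1 / 2 : ℝ) 1) {T : ℕ}
    (hK : 1 ≤ K) (hM : 1 ≤ M) (hT : 1 ≤ T) (hKMT : (K : ℝ) ≤ M * T) :
    ∃ (q : unitInterval) (v : ℝ) (j : Fin K × Fin 2), 0 ≤ v ∧
      (∀ k, spikeTask q (heights v j k) ∈ TwoArmedTask.heavyTailed α) ∧
      T * ((K : ℝ) / (M * T)) ^ (1 - α) / 16 ≤
        ∫ p, ∑ t ∈ Finset.range T, P.loss E p.1 (spikeLosses (heights v j) p.2) t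
          ∂(ρ.prod (bitsLaw q K)) := by
  have hK' : (1 : ℝ) ≤ K := by exact_mod_cast hK
  have hM' : (1 : ℝ) ≤ M := by exact_mod_cast hM
  have hT' : (1 : ℝ) ≤ T := by exact_mod_cast hT
  set x : ℝ := K / (M * T) with hx
  have hx0 : 0 < x := by positivity
  have hx1 : x ≤ 1 := (div_le_one (by positivity)).2 hKMT
  -- Since `M + 1 ≤ 2 * M`, the factor `1 / 4` brings `q * T * (M + 1)` down to at most `K / 2`.
  let q : unitInterval := ⟨x / 4, by positivity, by linarith⟩
  have hqx : (q : ℝ) = x / 4 := rfl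
  have hq0 : 0 < (q : ℝ) := by rw [hqx]; positivity
  set v : ℝ := (q : ℝ) ^ (-α) / 2 with hv
  have hv0 : 0 ≤ v := by positivity
  have hqT : (q : ℝ) * T * (M + 1) ≤ K / 2 := by
    have : x * (M * T) = K := by rw [hx]; field_simp
    rw [hqx]
    nlinarith [mul_nonneg (mul_nonneg hx0.le (by linarith : (0 : ℝ) ≤ T)) (sub_nonneg.2 hM')]
  obtain ⟨j, hj⟩ := P.exists_le_integral_loss_heights E ρ q hv0 hK hqT
  refine ⟨q, v, j, hv0, fun k => spikeTask_mem_heavyTailed hα q hq0 fun a => ?_, le_trans ?_ hj⟩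
  · simp only [heights]
    split_ifs
    · exact ⟨le_rfl, hv0⟩
    · exact ⟨hv0, le_rfl⟩
  · have hqv : q * v = (q : ℝ) ^ (1 - α) / 2 := by
      rw [hv, sub_eq_add_neg, Real.rpow_add hq0, Real.rpow_one]; ring
    -- Replacing `q` by `x` costs the factor `4 ^ (1 - α)`, uniformly at most `2` because `α ≥ 1 /
    -- 2`. With `q * v = q ^ (1 - α) / 2` and the earlier `1 / 4` this makes `1 / 16`.
    have h4 : (4 : ℝ) ^ (1 - α) ≤ 2 := by
      calc (4 : ℝ) ^ (1 - α) ≤ 4 ^ (1 / 2 : ℝ) :=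
            Real.rpow_le_rpow_of_exponent_le (by norm_num) (by linarith [hα.1])
        _ = 2 := by
          rw [← Real.sqrt_eq_rpow, show (4 : ℝ) = 2 ^ 2 by norm_num]
          exact Real.sqrt_sq (by norm_num)
    have hpow : x ^ (1 - α) / 2 ≤ (q : ℝ) ^ (1 - α) := by
      rw [hqx, Real.div_rpow hx0.le (by norm_num)]
      gcongr
    rw [hqv]
    nlinarith

lemma iInf_optLoss_heights (q : unitInterval) {v : ℝ} (hv : 0 ≤ v) (j : Fin K × Fin 2) :
    ⨅ k, (spikeTask q (heights v j k)).optLoss = 0 := by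
  have hnonneg (k : Fin K) : 0 ≤ (spikeTask q (heights v j k)).optLoss := by
    have (a : Fin 2) : 0 ≤ (spikeTask q (heights v j k)).mean a := by
      rw [spikeTask_mean, heights]
      have := q.2.1
      split_ifs <;> positivity
    exact le_min (this 0) (this 1)
  have : Nonempty (Fin K) := ⟨j.1⟩
  refine le_antisymm (ciInf_le_of_le (Set.finite_range _).bddBelow j.1 ?_) (le_ciInf hnonneg)
  have hj : (spikeTask q (heights v j j.1)).mean j.2 = 0 := by
    rw [spikeTask_mean, heights]; simp
  obtain ⟨k, a⟩ := j
  rw [← hj, TwoArmedTask.optLoss]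
  fin_cases a
  · exact min_le_left _ _
  · exact min_le_right _ _

lemma measurable_sum_loss_spikeLosses (P : MetaProcedure Ω K M) (E : Fin K → Expert Ω)
    (c : Fin K → Fin 2 → ℝ) (T : ℕ) :
    Measurable fun p : Ω × (ℕ → Fin K → Fin 2 → Bool) =>
      ∑ t ∈ Finset.range T, P.loss E p.1 (spikeLosses c p.2) t :=
  Finset.measurable_fun_sum _ fun t _ => P.measurable_loss_spikeLosses E c t

lemma expectedRegret_heights (P : MetaProcedure Ω K M) (E : Fin K → Expert Ω) (ρ : Measure Ω)
    [IsProbabilityMeasure ρ] (q : unitInterval) {v : ℝ} (hv : 0 ≤ v) (j : Fin K × Fin 2) (T : ℕ) :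
    P.expectedRegret E ρ (fun k => spikeTask q (heights v j k)) T =
      ∫ p, ∑ t ∈ Finset.range T, P.loss E p.1 (spikeLosses (heights v j) p.2) t
        ∂(ρ.prod (bitsLaw q K)) := by
  rw [expectedRegret, iInf_optLoss_heights q hv j]
  simp only [mul_zero, sub_zero]
  exact integral_runLaw_spikeTask ρ q (heights v j)
    (fun p => ∑ t ∈ Finset.range T, P.loss E p.1 p.2 t) (P.measurable_sum_loss_spikeLosses E _ T)

end MetaProcedure

/-! ### A single learner -/

namespace Policy

variable {Ω : Type} [MeasurableSpace Ω]

/-- The meta-procedure that trains and follows a single expert. -/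
def soleProcedure (Ω : Type) [MeasurableSpace Ω] : MetaProcedure Ω 1 1 where
  select _ _ := ({0}, 0)
  card_le _ _ := by simp
  advisor_mem _ _ := by simp
  measurable_select _ := measurable_const

/-- A learner as a sole expert that advises what it would pull. -/
def soleExpert (A : Policy Ω) : Fin 1 → Expert Ω := fun _ => ⟨A, A⟩

lemma expertHistory_soleProcedure (A : Policy Ω) (ω : Ω) (ξ : ℕ → Fin 1 → Fin 2 → ℝ) (t : ℕ) :
    expertHistory 0 ((soleProcedure Ω).history A.soleExpert ω ξ t) =
      A.history ω (fun s => ξ s 0) t := by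
  induction t with
  | zero => rfl
  | succ t ih =>
    rw [history, ← ih]
    simp [MetaProcedure.history, expertHistory, MetaProcedure.round, soleProcedure, soleExpert,
      RoundRecord.trained, RoundRecord.observation]

lemma loss_soleProcedure (A : Policy Ω) (ω : Ω) (ξ : ℕ → Fin 1 → Fin 2 → ℝ) (t : ℕ) :
    (soleProcedure Ω).loss A.soleExpert ω ξ t = ξ t 0 (A.arm ω (fun s => ξ s 0) t) := by
  rw [arm, ← expertHistory_soleProcedure]
  rfl

/-- The identification of the two outcome spaces is a measurable equivalence, so no measurability of
`g` is needed. -/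
lemma integral_runLaw_eq (ρ : Measure Ω) [IsProbabilityMeasure ρ] (f : TwoArmedTask)
    (g : Ω × (ℕ → Fin 2 → ℝ) → ℝ) :
    ∫ p, g p ∂(runLaw ρ f) =
      ∫ p, g (p.1, fun t => p.2 t 0) ∂(MetaProcedure.runLaw ρ fun _ : Fin 1 => f) := by
  let e : (ℕ → Fin 1 → Fin 2 → ℝ) ≃ᵐ (ℕ → Fin 2 → ℝ) :=
    MeasurableEquiv.piCongrRight fun _ => MeasurableEquiv.funUnique (Fin 1) (Fin 2 → ℝ)
  have he : MeasurePreserving e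
      (Measure.infinitePi fun _ : ℕ => Measure.pi fun _ : Fin 1 => f.outcomeLaw)
      (Measure.infinitePi fun _ : ℕ => f.outcomeLaw) := by
    refine ⟨e.measurable, ?_⟩
    have h1 := (measurePreserving_funUnique f.outcomeLaw (Fin 1)).map_eq
    have h2 := Measure.infinitePi_map_pi
      (fun _ : ℕ => Measure.pi fun _ : Fin 1 => f.outcomeLaw)
      (f := fun _ => MeasurableEquiv.funUnique (Fin 1) (Fin 2 → ℝ))
      (fun _ => MeasurableEquiv.measurable _)
    exact h2.trans (by congr 1; funext _; exact h1)
  have hprod : MeasurePreserving ((MeasurableEquiv.refl Ω).prodCongr e)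
      (MetaProcedure.runLaw ρ fun _ : Fin 1 => f) (runLaw ρ f) :=
    (MeasurePreserving.id ρ).prod he
  exact (hprod.integral_comp' g).symm

/-- A lone learner is the case `K = M = 1` of the protocol, where the rate `T * (1 / T) ^ (1 - α)`
is `T ^ α`. -/
theorem heavyTailed_hasAlphaRegretLowerBound {α : ℝ} (hα : α ∈ Set.Icc (1 / 2 : ℝ) 1) :
    HasAlphaRegretLowerBound (TwoArmedTask.heavyTailed α) α := by
  refine ⟨1 / 16, by norm_num, fun Ω _ ρ _ A T hT => ?_⟩
  have hT' : (1 : ℝ) ≤ T := by exact_mod_cast hT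
  obtain ⟨q, v, j, hv, hmem, hle⟩ := (soleProcedure Ω).exists_spikeTask_le_integral_loss
    A.soleExpert ρ hα le_rfl le_rfl hT (by simpa using hT')
  have hrate : (T : ℝ) * (((1 : ℕ) : ℝ) / (((1 : ℕ) : ℝ) * T)) ^ (1 - α) / 16 =
      1 / 16 * (T : ℝ) ^ α := by
    rw [Nat.cast_one, one_mul, one_div, Real.inv_rpow (by positivity),
      ← Real.rpow_neg (by positivity), neg_sub, Real.rpow_sub_one (by positivity)]
    field_simp
  rw [hrate] at hle
  obtain ⟨k, a⟩ := j
  obtain rfl : k = 0 := Subsingleton.elim _ _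
  set f := spikeTask q (MetaProcedure.heights v ((0 : Fin 1), a) 0) with hf
  have hconst : (fun _ : Fin 1 => f) =
      fun k => spikeTask q (MetaProcedure.heights v ((0 : Fin 1), a) k) := by
    funext k; rw [Subsingleton.elim k 0]
  have hopt : f.optLoss = 0 := by
    rw [← MetaProcedure.iInf_optLoss_heights q hv ((0 : Fin 1), a), ciInf_unique]
    rfl
  have hregret : A.expectedRegret ρ f T =
      ∫ p, ∑ t ∈ Finset.range T, (soleProcedure Ω).loss A.soleExpert p.1
        (spikeLosses (MetaProcedure.heights v ((0 : Fin 1), a)) p.2) t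
          ∂(ρ.prod (bitsLaw q 1)) := by
    rw [expectedRegret, hopt, mul_zero, sub_zero, integral_runLaw_eq, hconst,
      MetaProcedure.integral_runLaw_spikeTask]
    · simp_rw [loss_soleProcedure]
    · simpa only [loss_soleProcedure] using
        (soleProcedure Ω).measurable_sum_loss_spikeLosses A.soleExpert _ T
  -- The hidden arm has no loss on any outcome, not merely on average, so the comparator in
  -- hindsight is `0` as well and both regrets equal the cumulative loss.
  have hmin (b : ℕ → Fin 1 → Fin 2 → Bool) :
      min (∑ t ∈ Finset.range T, spikeLosses (MetaProcedure.heights v ((0 : Fin 1), a)) b t 0 0)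
        (∑ t ∈ Finset.range T,
          spikeLosses (MetaProcedure.heights v ((0 : Fin 1), a)) b t 0 1) = 0 := by
    have h0 (i : Fin 2) : 0 ≤ ∑ t ∈ Finset.range T,
        spikeLosses (MetaProcedure.heights v ((0 : Fin 1), a)) b t 0 i :=
      Finset.sum_nonneg fun t _ => (spikeLosses_heights_mem_Icc hv _ b t 0 i).1
    have ha : ∑ t ∈ Finset.range T,
        spikeLosses (MetaProcedure.heights v ((0 : Fin 1), a)) b t 0 a = 0 :=
      Finset.sum_eq_zero fun t _ => by simp [spikeLosses, spike, MetaProcedure.heights]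
    obtain rfl | rfl : a = 0 ∨ a = 1 := by omega
    · rw [ha]; exact min_eq_left (h0 1)
    · rw [ha]; exact min_eq_right (h0 0)
  have hhindsight : A.expectedHindsightRegret ρ f T =
      ∫ p, ∑ t ∈ Finset.range T, (soleProcedure Ω).loss A.soleExpert p.1
        (spikeLosses (MetaProcedure.heights v ((0 : Fin 1), a)) p.2) t
          ∂(ρ.prod (bitsLaw q 1)) := by
    rw [expectedHindsightRegret, integral_runLaw_eq, hconst,
      MetaProcedure.integral_runLaw_spikeTask]
    · simp_rw [hmin, loss_soleProcedure, sub_zero]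
    · simp_rw [hmin, sub_zero]
      simpa only [loss_soleProcedure] using
        (soleProcedure Ω).measurable_sum_loss_spikeLosses A.soleExpert _ T
  exact ⟨le_iSup₂_of_le f (hmem 0) (EReal.coe_le_coe_iff.2 (hle.trans_eq hregret.symm)),
    le_iSup₂_of_le f (hmem 0) (EReal.coe_le_coe_iff.2 (hle.trans_eq hhindsight.symm))⟩

end Policy

/-! ### ### Comparison of rates and the final bound -/

lemma le_mul_of_sqrt_mul_log_div_le {K M T : ℕ} (hM : 1 ≤ M) (hT : 1 ≤ T)
    (h : Real.sqrt ((K : ℝ) * Real.log K / ((M : ℝ) * T)) ≤ 1 / 2) : (K : ℝ) ≤ M * T := by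
  have hMT : (1 : ℝ) ≤ (M : ℝ) * T := by exact_mod_cast Nat.mul_pos hM hT
  rcases Nat.lt_or_ge K 2 with hK | hK
  · have : (K : ℝ) ≤ 1 := by exact_mod_cast Nat.lt_succ_iff.1 hK
    linarith
  -- For `K ≥ 2` the logarithm is at least `1 / 2`, so the squared hypothesis `K * log K ≤ M * T /
  -- 4` is more than enough.
  · have hlog : 1 / 2 ≤ Real.log K := by
      have := Real.log_le_log (by norm_num) (by exact_mod_cast hK : (2 : ℝ) ≤ K)
      linarith [Real.log_two_gt_d9]
    have h' := (Real.sqrt_le_left (by norm_num)).1 h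
    rw [div_le_iff₀ (by linarith)] at h'
    nlinarith [mul_le_mul_of_nonneg_left hlog (Nat.cast_nonneg (α := ℝ) K)]

/-- Each term on the left, without its constant, is at most `T * x ^ (1 - α)` for `x = K / (M * T)`,
the second with equality; the constant `1 / 16` is split evenly between them. -/
lemma sqrt_add_rpow_le {K M T α : ℝ} (hα : α ∈ Set.Icc (1 / 2 : ℝ) 1) (hK : 0 < K) (hM : 0 < M)
    (hT : 0 < T) (hKMT : K ≤ M * T) :
    1 / 32 * Real.sqrt (K * T / M) + 1 / 32 * (T ^ α * (K / M) ^ (1 - α)) ≤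
      T * (K / (M * T)) ^ (1 - α) / 16 := by
  set x := K / (M * T) with hx
  have hx0 : 0 < x := by positivity
  have hx1 : x ≤ 1 := (div_le_one (by positivity)).2 hKMT
  have h1 : Real.sqrt (K * T / M) ≤ T * x ^ (1 - α) := by
    have : K * T / M = T ^ 2 * x := by rw [hx]; field_simp
    rw [this, Real.sqrt_mul (by positivity), Real.sqrt_sq hT.le, Real.sqrt_eq_rpow]
    exact mul_le_mul_of_nonneg_left
      (Real.rpow_le_rpow_of_exponent_ge hx0 hx1 (by linarith [hα.1])) hT.le
  have h2 : T ^ α * (K / M) ^ (1 - α) = T * x ^ (1 - α) := by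
    have : K / M = T * x := by rw [hx]; field_simp
    rw [this, Real.mul_rpow hT.le hx0.le, ← mul_assoc, ← Real.rpow_add hT]
    simp
  rw [h2]
  linarith

end

theorem mainTheorem2 :
    ∃ c₁ c₂ s₀ : ℝ, 0 < c₁ ∧ 0 < c₂ ∧ 0 < s₀ ∧
      ∀ α : ℝ, α ∈ Set.Icc (1 / 2 : ℝ) 1 →
        ∃ F : Set TwoArmedTask, F ⊆ TwoArmedTask.heavyTailed α ∧
          HasAlphaRegretLowerBound F α ∧
          ∀ K M T : ℕ, 1 ≤ K → 1 ≤ M → 1 ≤ T →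
            Real.sqrt ((K : ℝ) * Real.log K / ((M : ℝ) * T)) ≤ s₀ →
            ∀ (Ω : Type) [MeasurableSpace Ω] (ρ : Measure Ω) [IsProbabilityMeasure ρ]
              (P : MetaProcedure Ω K M) (E : Fin K → Expert Ω),
              ((c₁ * Real.sqrt ((K : ℝ) * T / M) +
                  c₂ * ((T : ℝ) ^ α * ((K : ℝ) / M) ^ (1 - α)) : ℝ) : EReal) ≤
                ⨆ f : Fin K → TwoArmedTask, ⨆ _ : ∀ k, f k ∈ F,
                  ((P.expectedRegret E ρ f T : ℝ) : EReal) := by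
  refine ⟨1 / 32, 1 / 32, 1 / 2, by norm_num, by norm_num, by norm_num, fun α hα =>
    ⟨TwoArmedTask.heavyTailed α, subset_rfl, Policy.heavyTailed_hasAlphaRegretLowerBound hα, ?_⟩⟩
  intro K M T hK hM hT hs Ω _ ρ _ P E
  have hKMT := le_mul_of_sqrt_mul_log_div_le hM hT hs
  obtain ⟨q, v, j, hv, hmem, hle⟩ := P.exists_spikeTask_le_integral_loss E ρ hα hK hM hT hKMT
  refine le_iSup₂_of_le _ hmem (EReal.coe_le_coe_iff.2 ?_)
  rw [P.expectedRegret_heights E ρ q hv j T]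
  exact (sqrt_add_rpow_le hα (by exact_mod_cast hK) (by exact_mod_cast hM)
    (by exact_mod_cast hT) hKMT).trans hle
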